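/- Let $G$ be a finite simple graph of order $n$ with average degree $d=\frac1n\sum_{v}d_v$ and smallest degree $\delta>0$. Let $0=\sigma_0\le\sigma_1\le\cdots\le\sigma_{n-1}$ be the eigenvalues, with multiplicity, of its Laplacian matrix $L(G)=D(G)-A(G)$, where $D(G)$ is the diagonal matrix of vertex degrees and $A(G)$ is the adjacency matrix. Let $\theta$ be a real number such that $|d-\sigma_i|\le\theta$ for all $i\ne 0$, and suppose that $$\delta-(2+2\sqrt3)^2\,\frac{\theta^2}{\delta}\ \ge\ \frac{2n\theta+d}{d+\theta}.$$ Then $G$ is Hamiltonian, i.e. $G$ has a Hamilton cycle. -/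

import Mathlib

namespace SimpleGraph

/-- The average degree `d = vol(G) / n = (∑ v, d_v) / n` of a finite graph, as a real number. -/
noncomputable def avgDegree {V : Type*} [Fintype V] (G : SimpleGraph V) [DecidableRel G.Adj] : ℝ :=
  (∑ v : V, (G.degree v : ℝ)) / (Fintype.card V : ℝ)

/-- The Laplacian eigenvalues `σ_0 ≤ σ_1 ≤ ⋯ ≤ σ_{n-1}` of a graph on `n` vertices: the
eigenvalues, with multiplicity and in increasing order, of the Laplacian matrix `L = D - A`.
Mathlib's `eigenvalues₀` lists them in decreasing order, so the index is reversed. -/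
noncomputable def lapEigenvalue {V : Type*} [Fintype V] [DecidableEq V] (G : SimpleGraph V)
    [DecidableRel G.Adj] (i : Fin (Fintype.card V)) : ℝ :=
  (G.isHermitian_lapMatrix ℝ).eigenvalues₀ i.rev

theorem lapEigenvalue_monotone {V : Type*} [Fintype V] [DecidableEq V] (G : SimpleGraph V)
    [DecidableRel G.Adj] : Monotone G.lapEigenvalue := fun _ _ h =>
  (G.isHermitian_lapMatrix ℝ).eigenvalues₀_antitone (Fin.rev_le_rev.mpr h)

end SimpleGraph

/-
If a graph with an edge is not Hamiltonian, take a longest cycle and a component of its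
complement. The vertices `S` of the cycle adjacent to that component form a vertex cut, and their
successors on the cycle together with a vertex of the component form an independent set, of
size `|S| + 1`. By the expander mixing lemma for the Laplacian an independent set has at most
`(2nθ + d - θ) / (d + θ)` vertices, so that `S` is small compared with `δ`. A second application
of the lemma shows that each side of so small a cut has more than `n / 5` vertices, and a third
one that two sets of that size are joined by an edge, a contradiction.
-/

open Matrix
open scoped InnerProductSpace

section LongestCycle

variable {V : Type*} {G : SimpleGraph V} {u v w x y : V}

/-- The edge from the end `u` of the path `p` back to its start `x` closes `p` to a longest cycle
of `G`. An edge traversed back and forth counts as a cycle of length two, so that every graph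
with an edge has a longest cycle. -/
structure IsLongestCyclePath (p : G.Walk x u) : Prop where
  isPath : p.IsPath
  adj : G.Adj u x
  length_le : ∀ {y v : V} (q : G.Walk y v), q.IsPath → G.Adj v y → q.length ≤ p.length

theorem exists_isLongestCyclePath [Finite V] (hG : G ≠ ⊥) :
    ∃ (x u : V) (p : G.Walk x u), IsLongestCyclePath p := by
  have := Fintype.ofFinite V
  let s : Set ℕ := {k | ∃ (x u : V) (p : G.Walk x u), p.IsPath ∧ G.Adj u x ∧ p.length = k}
  have hbdd : BddAbove s :=
    ⟨Fintype.card V, by rintro k ⟨x, u, p, hp, -, rfl⟩; exact hp.length_lt.le⟩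
  obtain ⟨x, u, hxu⟩ := SimpleGraph.ne_bot_iff_exists_adj.1 hG
  have hne : s.Nonempty := ⟨_, x, u, hxu.toWalk, .of_adj hxu, hxu.symm, rfl⟩
  obtain ⟨x, u, p, hp, hux, hlen⟩ := Nat.sSup_mem hne hbdd
  exact ⟨x, u, p, hp, hux, fun q hq hadj => hlen ▸ le_csSup hbdd ⟨_, _, q, hq, hadj, rfl⟩⟩

theorem exists_isPath_of_preconnected_induce {A : Set V} (hA : (G.induce A).Preconnected)
    {a b : V} (ha : a ∈ A) (hb : b ∈ A) :
    ∃ p : G.Walk a b, p.IsPath ∧ ∀ y ∈ p.support, y ∈ A := by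
  obtain ⟨p, hp⟩ := (hA ⟨a, ha⟩ ⟨b, hb⟩).exists_isPath
  refine ⟨p.map (SimpleGraph.Embedding.induce A).toHom, hp.map Subtype.val_injective,
    fun y hy => ?_⟩
  have hy' := (SimpleGraph.Walk.support_map (SimpleGraph.Embedding.induce A).toHom p) ▸ hy
  obtain ⟨z, -, rfl⟩ := List.mem_map.1 hy'
  exact z.2

theorem exists_preconnected_induce_of_notMem (G : SimpleGraph V) {s : Set V} (hv : v ∉ s) :
    ∃ A : Set V, v ∈ A ∧ Disjoint A s ∧ (G.induce A).Preconnected ∧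
      ∀ a ∈ A, ∀ y, G.Adj a y → y ∈ A ∪ s := by
  let H : SimpleGraph V := (G.induce sᶜ).spanningCoe
  have hadj {a b : V} : H.Adj a b ↔ G.Adj a b ∧ a ∉ s ∧ b ∉ s := by simp [H]
  let C := H.connectedComponentMk v
  have hdisj : Disjoint C.supp s := by
    rw [Set.disjoint_left]
    rintro a ha has
    obtain ⟨p⟩ : H.Reachable a v := SimpleGraph.ConnectedComponent.exact ha
    cases p with
    | nil => exact hv has
    | cons h _ => exact (hadj.1 h).2.1 has
  refine ⟨C.supp, rfl, hdisj, ?_, fun a ha y hay => ?_⟩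
  · exact C.connected_toSimpleGraph.preconnected.mono
      (SimpleGraph.comap_monotone _ fun _ _ h => (hadj.1 h).1)
  · by_cases hys : y ∈ s
    · exact Or.inr hys
    · have hH : H.Adj a y := hadj.2 ⟨hay, Set.disjoint_left.1 hdisj ha, hys⟩
      exact Or.inl (C.mem_supp_of_adj_mem_supp ha hH)

/-- Otherwise a detour through `A` would turn `q` into a longer cycle. -/
theorem IsLongestCyclePath.not_adj_of_adj {p : G.Walk x u} (hp : IsLongestCyclePath p)
    {A : Set V} (hA : (G.induce A).Preconnected) (hAp : ∀ a ∈ A, a ∉ p.support)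
    {q : G.Walk y v} (hq : q.support.Perm p.support) {a b : V} (ha : a ∈ A) (hb : b ∈ A)
    (hva : G.Adj v a) : ¬G.Adj y b := by
  intro hyb
  obtain ⟨r, hr, hrA⟩ := exists_isPath_of_preconnected_induce hA ha hb
  let c : G.Walk y b := q.append (SimpleGraph.Walk.cons hva r)
  have hc : c.support = q.support ++ r.support := by
    simp only [c, SimpleGraph.Walk.support_append, SimpleGraph.Walk.support_cons, List.tail_cons]
  have hcpath : c.IsPath := by
    rw [SimpleGraph.Walk.isPath_def, hc, List.nodup_append']
    exact ⟨hq.nodup_iff.2 hp.isPath.support_nodup, hr.support_nodup,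
      fun z hzq hzr => hAp z (hrA z hzr) (hq.subset hzq)⟩
  have hle := hp.length_le c hcpath hyb.symm
  have hlen := congrArg List.length hc
  simp only [List.length_append, SimpleGraph.Walk.length_support, hq.length_eq] at hlen
  omega

section Successor

variable [DecidableEq V]

/- For a path `p` closed to a cycle by an edge from its end to its start, `p.support.formPerm` is
the successor map along that cycle. -/
theorem formPerm_support_end (p : G.Walk x u) : p.support.formPerm u = x := by
  have h := List.formPerm_apply_getLast x p.support.tail
  simpa only [p.cons_tail_support, p.getLast_support] using h

theorem exists_support_eq_append {p : G.Walk x u} (hp : p.IsPath) (hw : w ∈ p.support)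
    (hwu : w ≠ u) :
    ∃ (q : G.Walk x w) (r : G.Walk (p.support.formPerm w) u),
      p.support = q.support ++ r.support := by
  obtain ⟨y, hwy, r, hr⟩ := SimpleGraph.Walk.exists_eq_cons_of_ne hwu (p.dropUntil w hw)
  let q := p.takeUntil w hw
  have hqr : p.support = q.support ++ r.support := by
    rw [← p.take_spec hw, hr, SimpleGraph.Walk.support_append, SimpleGraph.Walk.support_cons,
      List.tail_cons]
  have hy : p.support.formPerm w = y := by
    have hrot : p.support ~r r.support ++ q.support := hqr ▸ List.isRotated_append
    rw [List.formPerm_eq_of_isRotated hp.support_nodup hrot]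
    simpa only [← List.cons_append, r.cons_tail_support,
      List.getLast_append_of_right_ne_nil _ _ q.support_ne_nil, q.getLast_support] using
        List.formPerm_apply_getLast y (r.support.tail ++ q.support)
  subst hy
  exact ⟨q, r, hqr⟩

theorem exists_isRotated_support_of_mem {p : G.Walk x u} (hp : p.IsPath) (hux : G.Adj u x)
    (hw : w ∈ p.support) :
    ∃ q : G.Walk (p.support.formPerm w) w, p.support ~r q.support := by
  obtain rfl | hwu := eq_or_ne w u
  · exact ⟨p.copy (formPerm_support_end p).symm rfl, by rw [SimpleGraph.Walk.support_copy]⟩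
  · obtain ⟨q, r, hqr⟩ := exists_support_eq_append hp hw hwu
    refine ⟨r.append (SimpleGraph.Walk.cons hux q), ?_⟩
    calc
      p.support = q.support ++ r.support := hqr
      _ ~r r.support ++ q.support := List.isRotated_append
      _ = (r.append (SimpleGraph.Walk.cons hux q)).support := by
        rw [SimpleGraph.Walk.support_append, SimpleGraph.Walk.support_cons, List.tail_cons]

variable {p : G.Walk x u} {A : Set V}

theorem IsLongestCyclePath.not_adj_formPerm (hp : IsLongestCyclePath p)
    (hA : (G.induce A).Preconnected) (hAp : ∀ a ∈ A, a ∉ p.support) (hw : w ∈ p.support)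
    {a b : V} (ha : a ∈ A) (hb : b ∈ A) (hwa : G.Adj w a) :
    ¬G.Adj (p.support.formPerm w) b := by
  obtain ⟨q, hq⟩ := exists_isRotated_support_of_mem hp.isPath hp.adj hw
  exact hp.not_adj_of_adj hA hAp hq.perm.symm ha hb hwa

/-- If `y` and `w` were adjacent to `A` and their successors `y'` and `w'` to each other, the
path `w ⋯ y' w' ⋯ y` through the vertices of the cycle would join two neighbours of `A`. -/
theorem IsLongestCyclePath.not_adj_formPerm_formPerm (hp : IsLongestCyclePath p)
    (hA : (G.induce A).Preconnected) (hAp : ∀ a ∈ A, a ∉ p.support) (hy : y ∈ p.support)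
    (hw : w ∈ p.support) {a b : V} (ha : a ∈ A) (hb : b ∈ A) (hya : G.Adj y a)
    (hwb : G.Adj w b) :
    ¬G.Adj (p.support.formPerm y) (p.support.formPerm w) := by
  intro hadj
  obtain ⟨c, hc⟩ := exists_isRotated_support_of_mem hp.isPath hp.adj hy
  have hcpath : c.IsPath := c.isPath_def.2 (hc.nodup_iff.1 hp.isPath.support_nodup)
  have hwy : w ≠ y := by rintro rfl; exact hadj.ne rfl
  obtain ⟨q, r, hqr⟩ := exists_support_eq_append hcpath (hc.mem_iff.1 hw) hwy
  have hyw : G.Adj (p.support.formPerm y) (c.support.formPerm w) := by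
    rwa [← List.formPerm_eq_of_isRotated hp.isPath.support_nodup hc]
  have hperm : (q.reverse.append (SimpleGraph.Walk.cons hyw r)).support.Perm p.support :=
    calc
      _ = q.support.reverse ++ r.support := by
        rw [SimpleGraph.Walk.support_append, SimpleGraph.Walk.support_reverse,
          SimpleGraph.Walk.support_cons, List.tail_cons]
      List.Perm _ (q.support ++ r.support) := q.support.reverse_perm.append_right r.support
      _ = c.support := hqr.symm
      List.Perm _ p.support := hc.perm.symm
  exact hp.not_adj_of_adj hA hAp hperm ha hb hya hwb

theorem IsLongestCyclePath.isIndepSet_insert_image_formPerm (hp : IsLongestCyclePath p)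
    (hA : (G.induce A).Preconnected) (hAp : ∀ a ∈ A, a ∉ p.support) {s : Set V}
    (hs : ∀ y ∈ s, y ∈ p.support ∧ ∃ a ∈ A, G.Adj y a) (hv : v ∈ A) :
    G.IsIndepSet (insert v (p.support.formPerm '' s)) := by
  have hvs : ∀ y ∈ s, ¬G.Adj (p.support.formPerm y) v := fun y hy => by
    obtain ⟨hyp, a, ha, hya⟩ := hs y hy
    exact hp.not_adj_formPerm hA hAp hyp ha hv hya
  refine Set.pairwise_insert.2 ⟨?_, ?_⟩
  · rintro _ ⟨y, hy, rfl⟩ _ ⟨w, hw, rfl⟩ -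
    obtain ⟨hyp, a, ha, hya⟩ := hs y hy
    obtain ⟨hwp, b, hb, hwb⟩ := hs w hw
    exact hp.not_adj_formPerm_formPerm hA hAp hyp hwp ha hb hya hwb
  · rintro _ ⟨y, hy, rfl⟩ -
    exact ⟨fun h => hvs y hy h.symm, hvs y hy⟩

theorem IsLongestCyclePath.isHamiltonian [Fintype V] (hp : IsLongestCyclePath p)
    (hV : 3 ≤ Fintype.card V) (hmem : ∀ v, v ∈ p.support) : G.IsHamiltonian := by
  have hham : p.IsHamiltonian := hp.isPath.isHamiltonian_of_mem hmem
  have hcycle : (SimpleGraph.Walk.cons hp.adj p).IsCycle := by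
    rw [SimpleGraph.Walk.isCycle_iff_isPath_tail_and_le_length, SimpleGraph.Walk.length_cons,
      hham.length_eq]
    exact ⟨by simpa using hp.isPath, by omega⟩
  exact fun _ => ⟨u, _, SimpleGraph.Walk.isHamiltonianCycle_isCycle_and_isHamiltonian_tail.2
    ⟨hcycle, fun v => by simpa using hham v⟩⟩

end Successor

/-- The vertex set `S` separates the sides `A` and `B` of a partition of the remaining vertices
into two nonempty classes. -/
structure Separates (G : SimpleGraph V) [Fintype V] [DecidableEq V] (S A B : Finset V) : Prop where
  nonempty_left : A.Nonempty
  nonempty_right : B.Nonempty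
  disjoint_left : Disjoint A S
  disjoint_right : Disjoint B S
  disjoint : Disjoint A B
  union_eq : A ∪ B ∪ S = Finset.univ
  not_adj : ∀ a ∈ A, ∀ b ∈ B, ¬G.Adj a b

theorem separates_compl_union [Fintype V] [DecidableEq V] {S A : Finset V} (hA : A.Nonempty)
    (hAS : Disjoint A S) {z : V} (hzA : z ∉ A) (hzS : z ∉ S)
    (hadj : ∀ a ∈ A, ∀ b, G.Adj a b → b ∈ A ∪ S) : Separates G S A (A ∪ S)ᶜ where
  nonempty_left := hA
  nonempty_right := ⟨z, by simp only [Finset.mem_compl, Finset.mem_union, hzA, hzS, or_self,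
    not_false_eq_true]⟩
  disjoint_left := hAS
  disjoint_right := disjoint_compl_left.mono_right Finset.subset_union_right
  disjoint := disjoint_compl_right.mono_left Finset.subset_union_left
  union_eq := by rw [Finset.union_right_comm, Finset.union_compl]
  not_adj a ha b hb hab := Finset.mem_compl.1 hb (hadj a ha b hab)

theorem Separates.symm [Fintype V] [DecidableEq V] {S A B : Finset V} (h : Separates G S A B) :
    Separates G S B A where
  nonempty_left := h.nonempty_right
  nonempty_right := h.nonempty_left
  disjoint_left := h.disjoint_right
  disjoint_right := h.disjoint_left
  disjoint := h.disjoint.symm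
  union_eq := by rw [Finset.union_comm B A, h.union_eq]
  not_adj b hb a ha hab := h.not_adj a ha b hb hab.symm

theorem Separates.mem_union_of_adj [Fintype V] [DecidableEq V] {S A B : Finset V}
    (h : Separates G S A B) {a b : V} (ha : a ∈ A) (hab : G.Adj a b) : b ∈ A ∪ S := by
  have hb : b ∈ A ∪ B ∪ S := h.union_eq ▸ Finset.mem_univ b
  rw [Finset.union_right_comm, Finset.mem_union] at hb
  exact hb.resolve_right fun hbB => h.not_adj a ha b hbB hab

theorem exists_separates_of_not_isHamiltonian [Fintype V] [DecidableEq V]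
    (hV : 3 ≤ Fintype.card V) (hG : G ≠ ⊥) (hham : ¬G.IsHamiltonian) :
    ∃ S A B I : Finset V, Separates G S A B ∧ G.IsIndepSet I ∧ I.card = S.card + 1 := by
  classical
  obtain ⟨x, u, p, hp⟩ := exists_isLongestCyclePath hG
  obtain ⟨v, hv⟩ : ∃ v, v ∉ p.support := by
    by_contra! hmem
    exact hham (hp.isHamiltonian hV hmem)
  obtain ⟨A, hvA, hAp, hA, hAadj⟩ :=
    exists_preconnected_induce_of_notMem G (s := {y | y ∈ p.support}) hv
  rw [Set.disjoint_left] at hAp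
  let σ := p.support.formPerm
  let S : Finset V := {y | y ∈ p.support ∧ ∃ a ∈ A, G.Adj y a}
  have hS (y : V) : y ∈ S ↔ y ∈ p.support ∧ ∃ a ∈ A, G.Adj y a := Finset.mem_filter_univ y
  have hσ {y : V} (hy : y ∈ S) : σ y ∈ p.support ∧ σ y ∉ S := by
    obtain ⟨hyp, a, ha, hya⟩ := (hS y).1 hy
    refine ⟨List.formPerm_apply_mem_of_mem hyp, fun hσy => ?_⟩
    obtain ⟨-, b, hb, hyb⟩ := (hS _).1 hσy
    exact hp.not_adj_formPerm hA hAp hyp ha hb hya hyb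
  obtain ⟨z, hzp, hzS⟩ : ∃ z ∈ p.support, z ∉ S := by
    by_cases hu : u ∈ S
    · exact ⟨σ u, hσ hu⟩
    · exact ⟨u, p.end_mem_support, hu⟩
  refine ⟨S, A.toFinset, (A.toFinset ∪ S)ᶜ, insert v (S.image σ), ?_, ?_, ?_⟩
  · refine separates_compl_union ⟨v, Set.mem_toFinset.2 hvA⟩
      (Finset.disjoint_left.2 fun a ha haS => hAp (Set.mem_toFinset.1 ha) ((hS a).1 haS).1)
      (fun hzA => hAp (Set.mem_toFinset.1 hzA) hzp) hzS fun a ha b hab => ?_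
    rw [Set.mem_toFinset] at ha
    rw [Finset.mem_union, Set.mem_toFinset]
    exact (hAadj a ha b hab).imp_right fun hbp => (hS b).2 ⟨hbp, a, ha, hab.symm⟩
  · rw [Finset.coe_insert, Finset.coe_image]
    exact hp.isIndepSet_insert_image_formPerm hA hAp (fun y => (hS y).1) hvA
  · rw [Finset.card_insert_of_notMem, Finset.card_image_of_injective _ σ.injective]
    intro hvS
    obtain ⟨y, hy, rfl⟩ := Finset.mem_image.1 hvS
    exact hv (hσ hy).1

end LongestCycle

theorem norm_inner_apply_sub_le_of_orthonormalBasis {𝕜 E ι : Type*} [RCLike 𝕜]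
    [NormedAddCommGroup E] [InnerProductSpace 𝕜 E] [Fintype ι] (b : OrthonormalBasis ι 𝕜 E)
    {T : E →ₗ[𝕜] E} {μ : ι → 𝕜} (hT : ∀ i, T (b i) = μ i • b i) {d : 𝕜} {θ : ℝ} {x : E} (y : E)
    (hμ : ∀ i, ⟪b i, x⟫_𝕜 = 0 ∨ ‖d - μ i‖ ≤ θ) :
    ‖⟪x, T y⟫_𝕜 - d * ⟪x, y⟫_𝕜‖ ≤ θ * (‖x‖ * ‖y‖) := by
  obtain rfl | hx := eq_or_ne x 0
  · simp
  have hθ : 0 ≤ θ := by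
    obtain ⟨i, hi⟩ : ∃ i, ⟪b i, x⟫_𝕜 ≠ 0 := by
      by_contra! h
      rw [← b.sum_repr' x] at hx
      exact hx (Finset.sum_eq_zero fun i _ => by rw [h, zero_smul])
    exact (norm_nonneg _).trans ((hμ i).resolve_left hi)
  have hTy : ⟪x, T y⟫_𝕜 = ∑ i, μ i * (⟪x, b i⟫_𝕜 * ⟪b i, y⟫_𝕜) := by
    conv_lhs => rw [← b.sum_repr' y]
    simp only [map_sum, map_smul, hT, inner_sum, inner_smul_right]
    exact Finset.sum_congr rfl fun i _ => by ring
  have hterm (i : ι) : ‖(μ i - d) * (⟪x, b i⟫_𝕜 * ⟪b i, y⟫_𝕜)‖ ≤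
      θ * (‖⟪x, b i⟫_𝕜‖ * ‖⟪b i, y⟫_𝕜‖) := by
    rw [norm_mul, norm_mul, norm_sub_rev]
    rcases hμ i with h | h
    · rw [inner_eq_zero_symm.1 h, norm_zero, zero_mul, mul_zero, mul_zero]
    · gcongr
  calc
    ‖⟪x, T y⟫_𝕜 - d * ⟪x, y⟫_𝕜‖ = ‖∑ i, (μ i - d) * (⟪x, b i⟫_𝕜 * ⟪b i, y⟫_𝕜)‖ := by
      simp only [hTy, ← b.sum_inner_mul_inner x y, sub_mul, Finset.sum_sub_distrib,
        Finset.mul_sum]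
    _ ≤ θ * ∑ i, ‖⟪x, b i⟫_𝕜‖ * ‖⟪b i, y⟫_𝕜‖ := by
      rw [Finset.mul_sum]
      exact norm_sum_le_of_le _ fun i _ => hterm i
    _ ≤ θ * (√(∑ i, ‖⟪x, b i⟫_𝕜‖ ^ 2) * √(∑ i, ‖⟪b i, y⟫_𝕜‖ ^ 2)) := by
      gcongr
      exact Real.sum_mul_le_sqrt_mul_sqrt _ _ _
    _ = θ * (‖x‖ * ‖y‖) := by
      rw [b.sum_sq_norm_inner_left, b.sum_sq_norm_inner_right, Real.sqrt_sq (norm_nonneg x),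
        Real.sqrt_sq (norm_nonneg y)]

section Laplacian

variable {V : Type*} [Fintype V] [DecidableEq V] {G : SimpleGraph V} [DecidableRel G.Adj]
  {d θ : ℝ}

/-- All Laplacian eigenvalues of `G` except the smallest one, which is counted once, lie within
`θ` of `d`. -/
def LapEigenvaluesNear (G : SimpleGraph V) [DecidableRel G.Adj] (d θ : ℝ) : Prop :=
  ∀ i : Fin (Fintype.card V), (i : ℕ) ≠ 0 → |d - G.lapEigenvalue i| ≤ θ

theorem LapEigenvaluesNear.abs_sub_eigenvalues_le (hG : LapEigenvaluesNear G d θ) {i j : V}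
    (hij : i ≠ j)
    (hle : (G.isHermitian_lapMatrix ℝ).eigenvalues i ≤ (G.isHermitian_lapMatrix ℝ).eigenvalues j) :
    |d - (G.isHermitian_lapMatrix ℝ).eigenvalues j| ≤ θ := by
  let k : V ≃ Fin (Fintype.card V) :=
    (Fintype.equivOfCardEq (Fintype.card_fin _)).symm.trans Fin.revPerm
  have heig (v : V) : (G.isHermitian_lapMatrix ℝ).eigenvalues v = G.lapEigenvalue (k v) := by
    simp [k, Matrix.IsHermitian.eigenvalues, SimpleGraph.lapEigenvalue]
  rw [heig, heig] at hle
  rw [heig]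
  by_cases hj : (k j : ℕ) = 0
  · have hi : (k i : ℕ) ≠ 0 := fun hi => hij (k.injective (Fin.ext (hi.trans hj.symm)))
    rw [(G.lapEigenvalue_monotone (Fin.le_def.2 (by omega))).antisymm hle]
    exact hG _ hi
  · exact hG _ hj

theorem one_dotProduct_lapMatrix_mulVec (y : V → ℝ) : 1 ⬝ᵥ G.lapMatrix ℝ *ᵥ y = 0 := by
  have h : G.lapMatrix ℝ *ᵥ 1 = 0 := G.lapMatrix_mulVec_const_eq_zero
  rw [dotProduct_mulVec, ← mulVec_transpose, (G.isSymm_lapMatrix (R := ℝ)).eq, h, zero_dotProduct]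

theorem eigenvalues_lapMatrix_eq_zero_of_sum_ne_zero {i : V}
    (hi : ∑ v, (G.isHermitian_lapMatrix ℝ).eigenvectorBasis i v ≠ 0) :
    (G.isHermitian_lapMatrix ℝ).eigenvalues i = 0 := by
  have h := one_dotProduct_lapMatrix_mulVec (G := G)
    ((G.isHermitian_lapMatrix ℝ).eigenvectorBasis i)
  rw [(G.isHermitian_lapMatrix ℝ).mulVec_eigenvectorBasis, dotProduct_smul, one_dotProduct,
    smul_eq_mul] at h
  exact (mul_eq_zero.1 h).resolve_right hi

/-- The constant vectors are eigenvectors for the smallest eigenvalue, so a vector of zero sum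
has no component along the eigenvector of an eigenvalue far from `d`. -/
theorem LapEigenvaluesNear.inner_eigenvectorBasis_eq_zero_or
    (hG : LapEigenvaluesNear G d θ) {x : EuclideanSpace ℝ V} (hx : ∑ v, x v = 0) (i : V) :
    ⟪(G.isHermitian_lapMatrix ℝ).eigenvectorBasis i, x⟫_ℝ = 0 ∨
      ‖d - (G.isHermitian_lapMatrix ℝ).eigenvalues i‖ ≤ θ := by
  let hL := G.isHermitian_lapMatrix ℝ
  let b := hL.eigenvectorBasis
  let e : EuclideanSpace ℝ V := WithLp.toLp 2 1
  have he (z : EuclideanSpace ℝ V) : ⟪e, z⟫_ℝ = ∑ v, z v := by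
    simp [e, PiLp.inner_apply]
  by_cases h : ∃ j, j ≠ i ∧ ⟪e, b j⟫_ℝ ≠ 0
  · obtain ⟨j, hji, hj⟩ := h
    have hle : hL.eigenvalues j ≤ hL.eigenvalues i := by
      rw [eigenvalues_lapMatrix_eq_zero_of_sum_ne_zero (he (b j) ▸ hj)]
      exact (G.posSemidef_lapMatrix ℝ).eigenvalues_nonneg i
    exact Or.inr (hG.abs_sub_eigenvalues_le hji hle)
  · push Not at h
    have hsum (z : EuclideanSpace ℝ V) : ⟪e, b i⟫_ℝ * ⟪b i, z⟫_ℝ = ⟪e, z⟫_ℝ := by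
      rw [← b.sum_inner_mul_inner e z,
        Finset.sum_eq_single i (fun j _ hji => by rw [h j hji, zero_mul]) (by simp)]
    have hei : ⟪e, b i⟫_ℝ ≠ 0 := by
      intro h0
      have hee := hsum e
      rw [h0, zero_mul, eq_comm, inner_self_eq_zero] at hee
      exact one_ne_zero (congrArg (fun z : EuclideanSpace ℝ V => z i) hee)
    exact Or.inl ((mul_eq_zero.1 ((hsum x).trans (he x ▸ hx))).resolve_left hei)

theorem LapEigenvaluesNear.abs_dotProduct_lapMatrix_mulVec_sub_le
    (hG : LapEigenvaluesNear G d θ) {x : V → ℝ} (hx : ∑ v, x v = 0) (y : V → ℝ) :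
    |x ⬝ᵥ G.lapMatrix ℝ *ᵥ y - d * (x ⬝ᵥ y)| ≤ θ * (√(x ⬝ᵥ x) * √(y ⬝ᵥ y)) := by
  let hL := G.isHermitian_lapMatrix ℝ
  have hT (i : V) : toEuclideanLin (G.lapMatrix ℝ) (hL.eigenvectorBasis i) =
      hL.eigenvalues i • hL.eigenvectorBasis i := by
    ext v
    exact congrFun (hL.mulVec_eigenvectorBasis i) v
  have h := norm_inner_apply_sub_le_of_orthonormalBasis hL.eigenvectorBasis hT
    (WithLp.toLp 2 y) (hG.inner_eigenvectorBasis_eq_zero_or (x := WithLp.toLp 2 x) hx)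
  have hnorm (z : V → ℝ) : ‖WithLp.toLp 2 z‖ = √(z ⬝ᵥ z) := by
    rw [EuclideanSpace.norm_eq]
    simp [dotProduct, sq]
  rw [hnorm, hnorm, toLpLin_toLp, EuclideanSpace.inner_toLp_toLp, EuclideanSpace.inner_toLp_toLp,
    star_trivial, dotProduct_comm _ x, dotProduct_comm y x, Real.norm_eq_abs] at h
  exact h

end Laplacian

section ExpanderMixing

theorem card_interedges_eq_zero {V : Type*} {G : SimpleGraph V} [DecidableRel G.Adj]
    {A B : Finset V} (h : ∀ a ∈ A, ∀ b ∈ B, ¬G.Adj a b) : (G.interedges A B).card = 0 := by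
  rw [Finset.card_eq_zero, SimpleGraph.interedges, Rel.interedges, Finset.filter_eq_empty_iff]
  exact fun e he => h _ (Finset.mem_product.1 he).1 _ (Finset.mem_product.1 he).2

theorem nontrivial_of_minDegree_pos {V : Type*} [Fintype V] {G : SimpleGraph V}
    [DecidableRel G.Adj] (hδ : 0 < G.minDegree) : Nontrivial V :=
  not_subsingleton_iff_nontrivial.1 fun _ => hδ.ne' G.minDegree_of_subsingleton

variable {V : Type*} [Fintype V] [DecidableEq V] {G : SimpleGraph V} [DecidableRel G.Adj]
  {d θ : ℝ}

/-- The indicator function of `A` minus its mean, which is the orthogonal projection of the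
indicator function to the vectors of zero sum. -/
noncomputable def centeredIndicator (A : Finset V) (v : V) : ℝ :=
  (if v ∈ A then 1 else 0) - (A.card : ℝ) / Fintype.card V

theorem sum_centeredIndicator (A : Finset V) : ∑ v, centeredIndicator A v = 0 := by
  cases isEmpty_or_nonempty V
  · simp
  · have hn : (Fintype.card V : ℝ) ≠ 0 := Nat.cast_ne_zero.2 Fintype.card_ne_zero
    simp [centeredIndicator, mul_div_cancel₀ _ hn]

theorem centeredIndicator_dotProduct (A : Finset V) (y : V → ℝ) :
    centeredIndicator A ⬝ᵥ y = ∑ v ∈ A, y v - (A.card : ℝ) / Fintype.card V * ∑ v, y v := by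
  simp only [dotProduct, centeredIndicator, sub_mul, ite_mul, one_mul, zero_mul,
    Finset.sum_sub_distrib, Finset.sum_ite_mem, Finset.univ_inter, Finset.mul_sum]

theorem centeredIndicator_dotProduct_centeredIndicator (A B : Finset V) :
    centeredIndicator A ⬝ᵥ centeredIndicator B =
      ((A ∩ B).card : ℝ) - (A.card : ℝ) * B.card / Fintype.card V := by
  rw [centeredIndicator_dotProduct, sum_centeredIndicator]
  simp only [centeredIndicator, Finset.sum_sub_distrib, Finset.sum_ite_mem, Finset.sum_const,
    nsmul_eq_mul]
  ring

theorem centeredIndicator_dotProduct_self (A : Finset V) :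
    centeredIndicator A ⬝ᵥ centeredIndicator A =
      (A.card : ℝ) * Aᶜ.card / Fintype.card V := by
  cases isEmpty_or_nonempty V
  · simp [dotProduct]
  · have hn : (Fintype.card V : ℝ) ≠ 0 := Nat.cast_ne_zero.2 Fintype.card_ne_zero
    have hcompl : (A.card : ℝ) + Aᶜ.card = Fintype.card V := mod_cast A.card_add_card_compl
    rw [centeredIndicator_dotProduct_centeredIndicator, Finset.inter_self]
    field_simp
    linear_combination -(A.card : ℝ) * hcompl

theorem card_interedges_eq_sum (A B : Finset V) :
    (G.interedges A B).card = ∑ v ∈ A, (G.neighborFinset v ∩ B).card := by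
  rw [SimpleGraph.interedges, Rel.interedges, Finset.card_filter, Finset.sum_product]
  refine Finset.sum_congr rfl fun v _ => ?_
  rw [← Finset.card_filter, Finset.inter_comm, ← Finset.filter_mem_eq_inter]
  simp only [SimpleGraph.mem_neighborFinset]

theorem sum_degree_eq_card_interedges_add {A S : Finset V} (hAS : Disjoint A S)
    (hadj : ∀ a ∈ A, ∀ b, G.Adj a b → b ∈ A ∪ S) :
    ∑ v ∈ A, G.degree v = (G.interedges A A).card + (G.interedges A S).card := by
  rw [card_interedges_eq_sum, card_interedges_eq_sum, ← Finset.sum_add_distrib]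
  refine Finset.sum_congr rfl fun v hv => ?_
  have hsub : G.neighborFinset v ⊆ A ∪ S := fun b hb =>
    hadj v hv b ((G.mem_neighborFinset v b).1 hb)
  rw [← Finset.card_union_of_disjoint
    (hAS.mono Finset.inter_subset_right Finset.inter_subset_right),
    ← Finset.inter_union_distrib_left, Finset.inter_eq_left.2 hsub,
    G.card_neighborFinset_eq_degree]

theorem centeredIndicator_dotProduct_lapMatrix_mulVec (A B : Finset V) :
    centeredIndicator A ⬝ᵥ G.lapMatrix ℝ *ᵥ centeredIndicator B =
      ∑ v ∈ A ∩ B, (G.degree v : ℝ) - ((G.interedges A B).card : ℝ) := by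
  have hB (v : V) : (G.lapMatrix ℝ *ᵥ centeredIndicator B) v =
      (if v ∈ B then (G.degree v : ℝ) else 0) - ((G.neighborFinset v ∩ B).card : ℝ) := by
    rw [SimpleGraph.lapMatrix_mulVec_apply]
    simp only [centeredIndicator, Finset.sum_sub_distrib, Finset.sum_ite_mem, Finset.sum_const,
      nsmul_eq_mul, SimpleGraph.card_neighborFinset_eq_degree, mul_sub, mul_ite, mul_one, mul_zero]
    ring
  rw [centeredIndicator_dotProduct, ← one_dotProduct, one_dotProduct_lapMatrix_mulVec, mul_zero,
    sub_zero, card_interedges_eq_sum]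
  simp only [hB, Finset.sum_sub_distrib, Finset.sum_ite_mem, Nat.cast_sum]

theorem sqrt_centeredIndicator_dotProduct_self (A B : Finset V) :
    √(centeredIndicator A ⬝ᵥ centeredIndicator A) * √(centeredIndicator B ⬝ᵥ centeredIndicator B) =
      √(A.card * B.card * (Aᶜ.card * Bᶜ.card)) / Fintype.card V := by
  rw [centeredIndicator_dotProduct_self, centeredIndicator_dotProduct_self,
    ← Real.sqrt_mul (by positivity), div_mul_div_comm, Real.sqrt_div (by positivity),
    Real.sqrt_mul_self (by positivity), mul_mul_mul_comm]

/-- Expander mixing for the Laplacian, multiplied through by the number of vertices. -/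
theorem LapEigenvaluesNear.abs_interedges_sub_le (hG : LapEigenvaluesNear G d θ)
    (A B : Finset V) :
    |Fintype.card V * (∑ v ∈ A ∩ B, (G.degree v : ℝ) - (G.interedges A B).card) -
        d * (Fintype.card V * (A ∩ B).card - A.card * B.card)| ≤
      θ * √(A.card * B.card * (Aᶜ.card * Bᶜ.card)) := by
  cases isEmpty_or_nonempty V
  · simp [Finset.eq_empty_of_isEmpty A]
  have hn : (0 : ℝ) < Fintype.card V := Nat.cast_pos.2 Fintype.card_pos
  have h := hG.abs_dotProduct_lapMatrix_mulVec_sub_le (sum_centeredIndicator A)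
    (centeredIndicator B)
  rw [centeredIndicator_dotProduct_centeredIndicator,
    centeredIndicator_dotProduct_lapMatrix_mulVec, sqrt_centeredIndicator_dotProduct_self] at h
  calc
    _ = |Fintype.card V * (∑ v ∈ A ∩ B, (G.degree v : ℝ) - (G.interedges A B).card -
          d * ((A ∩ B).card - A.card * B.card / Fintype.card V))| := by
      congr 1
      field_simp
    _ ≤ Fintype.card V * (θ * (√(A.card * B.card * (Aᶜ.card * Bᶜ.card)) / Fintype.card V)) := by
      rw [abs_mul, abs_of_pos hn]
      gcongr
    _ = θ * √(A.card * B.card * (Aᶜ.card * Bᶜ.card)) := by field_simp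

theorem LapEigenvaluesNear.abs_interedges_self_sub_le (hG : LapEigenvaluesNear G d θ)
    (A : Finset V) :
    |Fintype.card V * (∑ v ∈ A, (G.degree v : ℝ) - ((G.interedges A A).card : ℝ)) -
      d * (A.card * Aᶜ.card)| ≤ θ * (A.card * Aᶜ.card) := by
  have hcompl : (A.card : ℝ) + Aᶜ.card = Fintype.card V := mod_cast A.card_add_card_compl
  have hsub : (Fintype.card V * A.card - A.card * A.card : ℝ) = A.card * Aᶜ.card := by
    rw [← hcompl]; ring
  have hsqrt : √(A.card * A.card * (Aᶜ.card * Aᶜ.card) : ℝ) = A.card * Aᶜ.card := by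
    rw [mul_mul_mul_comm, Real.sqrt_mul_self (by positivity)]
  have h := hG.abs_interedges_sub_le A A
  rwa [Finset.inter_self, hsub, hsqrt] at h

theorem LapEigenvaluesNear.abs_sum_degree_sub_le (hG : LapEigenvaluesNear G d θ) {I : Finset V}
    (hI : G.IsIndepSet I) :
    |Fintype.card V * ∑ v ∈ I, (G.degree v : ℝ) - d * (I.card * Iᶜ.card)| ≤
      θ * (I.card * Iᶜ.card) := by
  have hzero := card_interedges_eq_zero fun a ha b hb hab => hI ha hb hab.ne hab
  simpa only [hzero, Nat.cast_zero, sub_zero] using hG.abs_interedges_self_sub_le I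

theorem LapEigenvaluesNear.card_mul_minDegree_le (hG : LapEigenvaluesNear G d θ) {I : Finset V}
    (hI : G.IsIndepSet I) (hne : I.Nonempty) :
    (Fintype.card V * G.minDegree : ℝ) ≤ (d + θ) * Iᶜ.card := by
  have hi : (0 : ℝ) < I.card := Nat.cast_pos.2 hne.card_pos
  have hdeg : (I.card * G.minDegree : ℝ) ≤ ∑ v ∈ I, (G.degree v : ℝ) := by
    rw [← nsmul_eq_mul]
    exact Finset.card_nsmul_le_sum _ _ _ fun v _ => Nat.cast_le.2 (G.minDegree_le_degree v)
  refine le_of_mul_le_mul_left ?_ hi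
  calc
    (I.card * (Fintype.card V * G.minDegree) : ℝ) = Fintype.card V * (I.card * G.minDegree) :=
      mul_left_comm _ _ _
    _ ≤ Fintype.card V * ∑ v ∈ I, (G.degree v : ℝ) := by gcongr
    _ ≤ d * (I.card * Iᶜ.card) + θ * (I.card * Iᶜ.card) :=
      sub_le_iff_le_add'.1 (abs_le.1 (hG.abs_sum_degree_sub_le hI)).2
    _ = I.card * ((d + θ) * Iᶜ.card) := by ring

theorem LapEigenvaluesNear.abs_card_mul_degree_sub_le (hG : LapEigenvaluesNear G d θ) (v : V) :
    |Fintype.card V * G.degree v - d * (Fintype.card V - 1)| ≤ θ * (Fintype.card V - 1) := by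
  have h := hG.abs_sum_degree_sub_le (I := {v}) (by simp)
  have hcard : (1 : ℝ) + ({v}ᶜ : Finset V).card = Fintype.card V := by
    exact_mod_cast Finset.card_add_card_compl ({v} : Finset V)
  rwa [Finset.sum_singleton, Finset.card_singleton, Nat.cast_one, one_mul,
    ← sub_eq_iff_eq_add'.2 hcard.symm] at h

theorem LapEigenvaluesNear.minDegree_le_add (hG : LapEigenvaluesNear G d θ)
    (hδ : 0 < G.minDegree) : (G.minDegree : ℝ) ≤ d + θ := by
  have : Nontrivial V := nontrivial_of_minDegree_pos hδ
  obtain ⟨v, hv⟩ := G.exists_minimal_degree_vertex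
  have hn : (1 : ℝ) ≤ Fintype.card V := Nat.one_le_cast.2 Fintype.card_pos
  have hδ' : (0 : ℝ) < G.minDegree := Nat.cast_pos.2 hδ
  have h : (Fintype.card V * G.minDegree : ℝ) ≤ (d + θ) * (Fintype.card V - 1) := by
    rw [hv]
    linear_combination (abs_le.1 (hG.abs_card_mul_degree_sub_le v)).2
  have hpos : 0 < d + θ := pos_of_mul_pos_left
    ((mul_pos (zero_lt_one.trans_le hn) hδ').trans_le h) (sub_nonneg.2 hn)
  refine le_of_mul_le_mul_left (h.trans ?_) (zero_lt_one.trans_le hn)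
  linear_combination hpos

theorem LapEigenvaluesNear.mul_card_indepSet_le (hG : LapEigenvaluesNear G d θ) {I : Finset V}
    (hI : G.IsIndepSet I) (hne : I.Nonempty) :
    (d + θ) * I.card ≤ 2 * Fintype.card V * θ + d - θ := by
  have : Nonempty V := hne.to_type
  obtain ⟨v, hv⟩ := G.exists_minimal_degree_vertex
  have hcompl : (I.card : ℝ) + Iᶜ.card = Fintype.card V := mod_cast I.card_add_card_compl
  have hdeg := (abs_le.1 (hG.abs_card_mul_degree_sub_le v)).1
  rw [← hv] at hdeg
  linear_combination hdeg + hG.card_mul_minDegree_le hI hne + (d + θ) * hcompl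

theorem LapEigenvaluesNear.pos_of_avgDegree (hG : LapEigenvaluesNear G G.avgDegree θ)
    (hδ : 0 < G.minDegree) : 0 < θ := by
  have : Nontrivial V := nontrivial_of_minDegree_pos hδ
  have hn : (1 : ℝ) ≤ Fintype.card V := Nat.one_le_cast.2 Fintype.card_pos
  have hn0 : (0 : ℝ) < Fintype.card V := zero_lt_one.trans_le hn
  have hsum : ∑ v, (G.degree v : ℝ) = Fintype.card V * G.avgDegree := by
    rw [SimpleGraph.avgDegree, mul_div_cancel₀ _ hn0.ne']
  have hd : 0 < G.avgDegree :=
    div_pos (Finset.sum_pos (fun v _ => Nat.cast_pos.2 (hδ.trans_le (G.minDegree_le_degree v)))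
      Finset.univ_nonempty) hn0
  have hle : Fintype.card V * (Fintype.card V * G.avgDegree) ≤
      Fintype.card V * ((G.avgDegree + θ) * (Fintype.card V - 1)) := by
    rw [← hsum, Finset.mul_sum, ← nsmul_eq_mul (Fintype.card V)]
    refine Finset.sum_le_card_nsmul Finset.univ _ _ fun v _ => ?_
    linear_combination (abs_le.1 (hG.abs_card_mul_degree_sub_le v)).2
  refine pos_of_mul_pos_left (hd.trans_le ?_) (sub_nonneg.2 hn)
  linear_combination le_of_mul_le_mul_left hle hn0

theorem minDegree_le_card_add {A S : Finset V} (hA : A.Nonempty)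
    (hadj : ∀ a ∈ A, ∀ b, G.Adj a b → b ∈ A ∪ S) : G.minDegree ≤ A.card + S.card := by
  obtain ⟨a, ha⟩ := hA
  calc
    G.minDegree ≤ (G.neighborFinset a).card :=
      (G.minDegree_le_degree a).trans_eq (G.card_neighborFinset_eq_degree a).symm
    _ ≤ (A ∪ S).card :=
      Finset.card_le_card fun b hb => hadj a ha b ((G.mem_neighborFinset a b).1 hb)
    _ ≤ A.card + S.card := Finset.card_union_le A S

theorem LapEigenvaluesNear.sub_mul_card_compl_le (hG : LapEigenvaluesNear G d θ)
    {A S : Finset V} (hAS : Disjoint A S) (hadj : ∀ a ∈ A, ∀ b, G.Adj a b → b ∈ A ∪ S) :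
    (d - θ) * (A.card * Aᶜ.card) ≤
      d * (A.card * S.card) + θ * √(A.card * S.card * (Aᶜ.card * Sᶜ.card)) := by
  have hdeg : ∑ v ∈ A, (G.degree v : ℝ) = (G.interedges A A).card + (G.interedges A S).card :=
    mod_cast sum_degree_eq_card_interedges_add hAS hadj
  have hAA := (abs_le.1 (hG.abs_interedges_self_sub_le A)).1
  have hA_S := (abs_le.1 (hG.abs_interedges_sub_le A S)).1
  rw [Finset.disjoint_iff_inter_eq_empty.1 hAS, Finset.sum_empty, Finset.card_empty,
    Nat.cast_zero] at hA_S
  rw [hdeg] at hAA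
  linear_combination hAA + hA_S

theorem five_mul_sqrt_le {a s b t δ θ : ℝ} (ha : 0 ≤ a) (hs : 0 ≤ s) (hb : 0 ≤ b) (ht : 0 ≤ t)
    (hsδ : s ≤ δ) (hθ : 25 * θ ^ 2 ≤ δ * a) :
    5 * θ * √(a * s * (b * t)) ≤ δ * a * ((b + t) / 2) := by
  have hδ : 0 ≤ δ := hs.trans hsδ
  refine (le_abs_self _).trans (abs_le_of_sq_le_sq ?_ (by positivity))
  calc
    (5 * θ * √(a * s * (b * t))) ^ 2 = 25 * θ ^ 2 * a * s * (b * t) := by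
      rw [mul_pow, Real.sq_sqrt (by positivity)]
      ring
    _ ≤ δ * a * a * δ * ((b + t) / 2) ^ 2 := by
      gcongr
      linarith [sq_nonneg (b - t)]
    _ = (δ * a * ((b + t) / 2)) ^ 2 := by ring

theorem LapEigenvaluesNear.sub_mul_card_compl_le_of_card_add_le (hG : LapEigenvaluesNear G d θ)
    (hδ : 0 < G.minDegree) {A S : Finset V} (hA : A.Nonempty) (hAS : Disjoint A S)
    (hadj : ∀ a ∈ A, ∀ b, G.Adj a b → b ∈ A ∪ S)
    (hS : S.card + 25 * (θ ^ 2 / G.minDegree) ≤ G.minDegree) :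
    (d - θ) * Aᶜ.card ≤ d * S.card + G.minDegree / 10 * (Aᶜ.card + Sᶜ.card) := by
  have hδ' : (0 : ℝ) < G.minDegree := Nat.cast_pos.2 hδ
  have ha : (0 : ℝ) < A.card := Nat.cast_pos.2 hA.card_pos
  have hθA : 25 * θ ^ 2 ≤ G.minDegree * A.card := by
    have hδA : (G.minDegree : ℝ) ≤ A.card + S.card := mod_cast minDegree_le_card_add hA hadj
    have h : 25 * (θ ^ 2 / G.minDegree) ≤ A.card := by linarith
    rwa [← mul_div_assoc, div_le_iff₀' hδ'] at h
  have hSle : (S.card : ℝ) ≤ G.minDegree := by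
    linarith [(by positivity : 0 ≤ θ ^ 2 / (G.minDegree : ℝ))]
  have hsqrt := five_mul_sqrt_le ha.le (Nat.cast_nonneg S.card) (Nat.cast_nonneg Aᶜ.card)
    (Nat.cast_nonneg Sᶜ.card) hSle hθA
  refine le_of_mul_le_mul_left ?_ ha
  linear_combination hG.sub_mul_card_compl_le hAS hadj + hsqrt / 5

theorem five_mul_le_of_add_le {s δ θ : ℝ} (hs : 0 ≤ s) (hδ : 0 < δ)
    (h : s + 25 * (θ ^ 2 / δ) ≤ δ) : 5 * θ ≤ δ := by
  have hsq : 25 * θ ^ 2 / δ ≤ δ := by rw [mul_div_assoc]; linarith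
  rw [div_le_iff₀ hδ] at hsq
  exact (abs_le_of_sq_le_sq' (by linarith) hδ.le).2

theorem LapEigenvaluesNear.card_lt_five_mul_card (hG : LapEigenvaluesNear G d θ)
    (hδ : 0 < G.minDegree) {A S : Finset V} (hA : A.Nonempty)
    (hAS : Disjoint A S) (hadj : ∀ a ∈ A, ∀ b, G.Adj a b → b ∈ A ∪ S)
    (hS : (d + θ) * S.card ≤ 2 * Fintype.card V * θ)
    (hSδ : S.card + 25 * (θ ^ 2 / G.minDegree) ≤ G.minDegree) :
    Fintype.card V < 5 * A.card := by
  by_contra! hle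
  have : Nontrivial V := nontrivial_of_minDegree_pos hδ
  have hn : (0 : ℝ) < Fintype.card V := Nat.cast_pos.2 Fintype.card_pos
  have hδ' : (0 : ℝ) < G.minDegree := Nat.cast_pos.2 hδ
  have hδd := hG.minDegree_le_add hδ
  have hθ : 5 * θ ≤ G.minDegree := five_mul_le_of_add_le (Nat.cast_nonneg _) hδ' hSδ
  have hAc : 4 / 5 * (Fintype.card V : ℝ) ≤ Aᶜ.card := by
    have h : (A.card : ℝ) + Aᶜ.card = Fintype.card V := mod_cast A.card_add_card_compl
    have hle' : 5 * (A.card : ℝ) ≤ Fintype.card V := mod_cast hle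
    linarith
  have hSn : (S.card : ℝ) ≤ 2 / 5 * Fintype.card V := by
    refine le_of_mul_le_mul_left ?_ (hδ'.trans_le hδd)
    linear_combination hS + 2 / 5 * (Fintype.card V : ℝ) * (hθ.trans hδd)
  have hSc : (S.card : ℝ) + Sᶜ.card = Fintype.card V := mod_cast S.card_add_card_compl
  have hd : 0 < d := by linarith
  refine (mul_pos hd hn).not_ge ?_
  have hlower : 5 / 8 * d * Aᶜ.card ≤ (d - θ - G.minDegree / 10) * Aᶜ.card := by
    gcongr
    linarith
  have hupper : (d - G.minDegree / 10) * S.card ≤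
      (d - G.minDegree / 10) * (2 / 5 * Fintype.card V) := by
    gcongr
    linarith
  have hδn : (G.minDegree : ℝ) * Fintype.card V ≤ 5 / 4 * d * Fintype.card V := by
    gcongr
    linarith
  have hdA : d * (4 / 5 * Fintype.card V) ≤ d * Aᶜ.card := by gcongr
  have hbdry := hG.sub_mul_card_compl_le_of_card_add_le hδ hA hAS hadj hSδ
  rw [← eq_sub_iff_add_eq'] at hSc
  rw [hSc] at hbdry
  linarith

theorem LapEigenvaluesNear.exists_adj_of_card_lt (hG : LapEigenvaluesNear G d θ) (hθ : 0 < θ)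
    (hd : 4 * θ ≤ d) {A B : Finset V} (hAB : Disjoint A B) (hA : Fintype.card V < 5 * A.card)
    (hB : Fintype.card V < 5 * B.card) : ∃ a ∈ A, ∃ b ∈ B, G.Adj a b := by
  by_contra! hadj
  have h := (abs_le.1 (hG.abs_interedges_sub_le A B)).2
  rw [Finset.disjoint_iff_inter_eq_empty.1 hAB, card_interedges_eq_zero hadj, Finset.sum_empty,
    Finset.card_empty, Nat.cast_zero] at h
  have ha : (0 : ℝ) < A.card := Nat.cast_pos.2 (by omega)
  have hb : (0 : ℝ) < B.card := Nat.cast_pos.2 (by omega)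
  have hAcompl : (Aᶜ.card : ℝ) < 4 * A.card := by
    have := A.card_add_card_compl
    exact_mod_cast (by omega : Aᶜ.card < 4 * A.card)
  have hBcompl : (Bᶜ.card : ℝ) < 4 * B.card := by
    have := B.card_add_card_compl
    exact_mod_cast (by omega : Bᶜ.card < 4 * B.card)
  have hsqrt : √(A.card * B.card * (Aᶜ.card * Bᶜ.card)) < 4 * (A.card * B.card : ℝ) := by
    rw [Real.sqrt_lt' (by positivity)]
    calc
      (A.card * B.card * (Aᶜ.card * Bᶜ.card) : ℝ) <
          A.card * B.card * (4 * A.card * (4 * B.card)) := by gcongr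
      _ = (4 * (A.card * B.card)) ^ 2 := by ring
  have hlt : θ * √(A.card * B.card * (Aᶜ.card * Bᶜ.card)) < d * (A.card * B.card) :=
    calc
      _ < θ * (4 * (A.card * B.card)) := by gcongr
      _ = 4 * θ * (A.card * B.card) := by ring
      _ ≤ d * (A.card * B.card) := by gcongr
  linarith

theorem LapEigenvaluesNear.not_separates (hG : LapEigenvaluesNear G d θ) (hδ : 0 < G.minDegree)
    (hθ : 0 < θ) {S A B : Finset V}
    (hS : (d + θ) * S.card ≤ 2 * Fintype.card V * θ)
    (hSδ : S.card + 25 * (θ ^ 2 / G.minDegree) ≤ G.minDegree) : ¬Separates G S A B := by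
  intro h
  have hθδ : 5 * θ ≤ G.minDegree :=
    five_mul_le_of_add_le (Nat.cast_nonneg _) (Nat.cast_pos.2 hδ) hSδ
  have hA : Fintype.card V < 5 * A.card :=
    hG.card_lt_five_mul_card hδ h.nonempty_left h.disjoint_left
      (fun _ ha _ => h.mem_union_of_adj ha) hS hSδ
  have hB : Fintype.card V < 5 * B.card :=
    hG.card_lt_five_mul_card hδ h.nonempty_right h.disjoint_right
      (fun _ hb _ => h.symm.mem_union_of_adj hb) hS hSδ
  obtain ⟨a, ha, b, hb, hab⟩ := hG.exists_adj_of_card_lt hθ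
    (by linarith [hG.minDegree_le_add hδ]) h.disjoint hA hB
  exact h.not_adj a ha b hb hab

end ExpanderMixing

theorem three_le_card_of_one_lt_minDegree {V : Type*} [Fintype V] {G : SimpleGraph V}
    [DecidableRel G.Adj] (hδ : 1 < G.minDegree) : 3 ≤ Fintype.card V := by
  have : Nontrivial V := nontrivial_of_minDegree_pos (zero_lt_one.trans hδ)
  obtain ⟨v, hv⟩ := G.exists_minimal_degree_vertex
  have hlt := G.degree_lt_card_verts v
  omega

theorem ne_bot_of_minDegree_pos {V : Type*} [Fintype V] {G : SimpleGraph V}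
    [DecidableRel G.Adj] (hδ : 0 < G.minDegree) : G ≠ ⊥ := by
  have : Nontrivial V := nontrivial_of_minDegree_pos hδ
  obtain ⟨v, hv⟩ := G.exists_minimal_degree_vertex
  obtain ⟨w, hvw⟩ := (G.degree_pos_iff_exists_adj v).1 (hv ▸ hδ)
  exact SimpleGraph.ne_bot_iff_exists_adj.2 ⟨v, w, hvw⟩

theorem theorem3p3_general {V : Type*} [Fintype V] [DecidableEq V] (G : SimpleGraph V)
    [DecidableRel G.Adj] (hδ : 0 < G.minDegree) (d θ : ℝ) (hθ : 0 < θ)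
    (hσ : ∀ i : Fin (Fintype.card V), (i : ℕ) ≠ 0 → |d - G.lapEigenvalue i| ≤ θ)
    (h : (G.minDegree : ℝ) - 25 * (θ ^ 2 / (G.minDegree : ℝ)) ≥
      (2 * (Fintype.card V : ℝ) * θ + d) / (d + θ)) :
    G.IsHamiltonian := by
  have hG : LapEigenvaluesNear G d θ := hσ
  have : Nontrivial V := nontrivial_of_minDegree_pos hδ
  have hn : (1 : ℝ) ≤ Fintype.card V := Nat.one_le_cast.2 Fintype.card_pos
  have hδ' : (0 : ℝ) < G.minDegree := Nat.cast_pos.2 hδ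
  have hdθ : 0 < d + θ := hδ'.trans_le (hG.minDegree_le_add hδ)
  have hratio : 1 < (2 * (Fintype.card V : ℝ) * θ + d) / (d + θ) := by
    rw [one_lt_div hdθ]
    linarith [mul_le_mul_of_nonneg_right hn hθ.le]
  have hδ1 : 1 < G.minDegree := by
    have hpos : 0 ≤ θ ^ 2 / (G.minDegree : ℝ) := by positivity
    exact_mod_cast (by linarith : (1 : ℝ) < G.minDegree)
  by_contra hham
  obtain ⟨S, A, B, I, hsep, hI, hcard⟩ :=
    exists_separates_of_not_isHamiltonian (three_le_card_of_one_lt_minDegree hδ1)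
      (ne_bot_of_minDegree_pos hδ) hham
  have hIcard : (d + θ) * I.card ≤ 2 * Fintype.card V * θ + d - θ :=
    hG.mul_card_indepSet_le hI (Finset.card_pos.1 (by omega))
  rw [hcard, Nat.cast_add, Nat.cast_one] at hIcard
  have hSle : (S.card : ℝ) ≤ (2 * Fintype.card V * θ + d) / (d + θ) := by
    rw [le_div_iff₀' hdθ]
    linarith
  exact hG.not_separates hδ hθ (by linarith) (by linarith) hsep

theorem theorem3p3 {V : Type*} [Fintype V] [DecidableEq V] (G : SimpleGraph V)
    [DecidableRel G.Adj] (hδ : 0 < G.minDegree) (θ : ℝ)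
    (hσ : ∀ i : Fin (Fintype.card V), (i : ℕ) ≠ 0 → |G.avgDegree - G.lapEigenvalue i| ≤ θ)
    (h : (G.minDegree : ℝ) - (2 + 2 * Real.sqrt 3) ^ 2 * (θ ^ 2 / (G.minDegree : ℝ)) ≥
      (2 * (Fintype.card V : ℝ) * θ + G.avgDegree) / (G.avgDegree + θ)) :
    G.IsHamiltonian := by
  have hconst : (25 : ℝ) ≤ (2 + 2 * √3) ^ 2 := by
    nlinarith [Real.le_sqrt_of_sq_le (by norm_num : (3 / 2 : ℝ) ^ 2 ≤ 3)]
  exact theorem3p3_general G hδ _ θ (LapEigenvaluesNear.pos_of_avgDegree hσ hδ) hσ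
    (h.le.trans (by gcongr))
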